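/- Let $T$ tasks with data $X_t\in\mathbb R^{m_t\times d}$ (rows $X_{tj}$) and targets $Y_t\in\mathbb R^{m_t}$ be given, $t=1,\dots,T$. Let $\mathcal L_t$ be, for all $t$, either the least square loss $\mathcal L_t(w)=\|Y_t-X_tw\|_2^2$ (regression), or the logistic loss $\mathcal L_t(w)=\frac1{m_t}\sum_{j=1}^{m_t}\bigl[-Y_{tj}\log\sigma(X_{tj}w)-(1-Y_{tj})\log\sigma(-X_{tj}w)\bigr]$ with $\sigma$ the sigmoid and labels $Y_{tj}\in[0,1]$ (classification). Put $$H_{reg}=\max_t 2\|X_t^{\top}X_t\|\ \text{(spectral norm)},\qquad H_{class}=\max_t\frac1{m_t}\sum_{j=1}^{m_t}\|X_{tj}\|_2^2,$$ and let $H$ be $H_{reg}$ for regression and $H_{class}$ for classification. For $c,\lambda,\mu\ge 0$, $\rho>0$ and $w,u,y\in(\mathbb R^d)^T$ let $$L_\rho(w,u,y)=\sum_{t=1}^T\bigl[\mathcal L_t(w_t)+\mu\|w_t\|_2^2\bigr]+\lambda\sum_{t=1}^T\|u_t\|_1+c\sum_{t=1}^{T-1}\sum_{j=1}^d\max(0,-u_{t,j}u_{t+1,j})+\sum_{t=1}^T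 y_t^{\top}(w_t-u_t)+\frac\rho2\sum_{t=1}^T\|w_t-u_t\|_2^2 .$$ ($\lambda=0$ gives the model with squared $\ell_2$ regularization, $\mu=0$ the model with $\ell_1$ regularization.) The miADMM sequence $(w^k,u^k,y^k)_{k\ge0}$ starts from any $(w^0,u^0,y^0)$; in iteration $k$ one updates first $w_1,\dots,w_T$ and then $u_1,\dots,u_T$, one block after the other, replacing each block by a minimizer of $L_\rho$ in that block, with $y=y^k$ and all the other blocks at their latest values, and then sets $y^{k+1}=y^k+\rho(w^{k+1}-u^{k+1})$. Suppose that $\rho>2(H+2\mu)$ (that is, $\rho>2H$ when $\mu=0$), and let $$v^k=\min_{0\le l\le k}\Bigl(\sum_{t=1}^T\|w_t^{l+1}-w_t^l\|_2^2+\sum_{t=1}^T\|u_t^{l+1}-u_t^l\|_2^2\Bigr).$$ Then $v^k=o(1/k)$ as $k\to\infty$. -/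

import Mathlib

open Filter Asymptotics

namespace SRML

noncomputable section

/-- A stack `[v₁; …; v_T]` of `T` vectors of `ℝᵈ` with the Euclidean norm. -/
abbrev Stack (T d : ℕ) : Type := Fin T → EuclideanSpace ℝ (Fin d)

/-- The linear prediction `X_{tj} w_t` of the `j`-th instance of a task with data matrix `X`. -/
def predict {m d : ℕ} (X : Matrix (Fin m) (Fin d) ℝ) (j : Fin m)
    (w : EuclideanSpace ℝ (Fin d)) : ℝ :=
  ∑ i, X j i * w i

/-- Least square loss `‖Y - X w‖₂²` of one task. -/
def squaredLoss {m d : ℕ} (X : Matrix (Fin m) (Fin d) ℝ) (Y : Fin m → ℝ)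
    (w : EuclideanSpace ℝ (Fin d)) : ℝ :=
  ∑ j, (Y j - predict X j w) ^ 2

/-- Logistic loss of one task,
`(1/m) ∑ⱼ [- Yⱼ log σ(Xⱼ w) - (1 - Yⱼ) log σ(- Xⱼ w)]` with the sigmoid `σ`. -/
def logisticLoss {m d : ℕ} (X : Matrix (Fin m) (Fin d) ℝ) (Y : Fin m → ℝ)
    (w : EuclideanSpace ℝ (Fin d)) : ℝ :=
  (1 / (m : ℝ)) * ∑ j, (-(Y j * Real.log (Real.sigmoid (predict X j w)))
    - (1 - Y j) * Real.log (Real.sigmoid (-(predict X j w))))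

/-- `H_reg = max_t 2 ‖X_tᵀ X_t‖`, with the spectral norm. -/
def Hreg {T d : ℕ} {m : Fin T → ℕ} (X : (t : Fin T) → Matrix (Fin (m t)) (Fin d) ℝ) : ℝ :=
  ⨆ t, 2 * ‖Matrix.toEuclideanCLM (𝕜 := ℝ) ((X t).transpose * X t)‖

/-- `H_class = max_t (1/m_t) ∑ⱼ ‖X_{tj}‖²`, where `X_{tj}` is the `j`-th row of `X_t`. -/
def Hclass {T d : ℕ} {m : Fin T → ℕ} (X : (t : Fin T) → Matrix (Fin (m t)) (Fin d) ℝ) : ℝ :=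
  ⨆ t, (1 / (m t : ℝ)) * ∑ j, ‖WithLp.toLp 2 (X t j)‖ ^ 2

/-- The slack term `∑_{t=1}^{T-1} ∑ⱼ max(0, - u_{t,j} u_{t+1,j})`; the double sum runs over the
pairs of consecutive tasks. -/
def slack {T d : ℕ} (u : Stack T d) : ℝ :=
  ∑ t : Fin T, ∑ s : Fin T,
    if (s : ℕ) = t + 1 then ∑ j, max 0 (-(u t j * u s j)) else 0

/-- The augmented Lagrangian of
`min ∑ₜ [ℒₜ(wₜ) + μ ‖wₜ‖₂²] + λ ∑ₜ ‖uₜ‖₁ + c ∑_{t<T} ∑ⱼ max(0, - u_{t,j} u_{t+1,j})`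
subject to `w - u = 0`, with dual variable `y` and penalty parameter `ρ`. -/
def augLagrangian {T d : ℕ} (loss : Fin T → EuclideanSpace ℝ (Fin d) → ℝ)
    (mu lam c rho : ℝ) (w u y : Stack T d) : ℝ :=
  (∑ t, (loss t (w t) + mu * ‖w t‖ ^ 2)) + lam * ∑ t, ∑ j, |u t j| + c * slack u
    + (∑ t, inner ℝ (y t) (w t - u t)) + (rho / 2) * ∑ t, ‖w t - u t‖ ^ 2

/-- The stack `[new₁; …; new_{t-1}; x; old_{t+1}; …; old_T]` seen by the update of block `t`
when the blocks are updated one after the other. -/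
def sweep {T d : ℕ} (new old : Stack T d) (t : Fin T) (x : EuclideanSpace ℝ (Fin d)) :
    Stack T d :=
  fun s => if s < t then new s else if s = t then x else old s

/-- The sequence `(wᵏ, uᵏ, yᵏ)` is generated by the algorithm, from an arbitrary initial point
`(w⁰, u⁰, y⁰)`: in iteration `k` the blocks `w₁, …, w_T` and then `u₁, …, u_T` are
replaced, one after the other, by minimizers of the augmented Lagrangian in that block (all other
blocks having their latest values), and finally `y` is updated. -/
structure IsMiADMM {T d : ℕ} (loss : Fin T → EuclideanSpace ℝ (Fin d) → ℝ)
    (mu lam c rho : ℝ) (w u y : ℕ → Stack T d) : Prop where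
  w_step : ∀ k t, IsMinOn
    (fun x => augLagrangian loss mu lam c rho (sweep (w (k + 1)) (w k) t x) (u k) (y k))
    Set.univ (w (k + 1) t)
  u_step : ∀ k t, IsMinOn
    (fun x => augLagrangian loss mu lam c rho (w (k + 1)) (sweep (u (k + 1)) (u k) t x) (y k))
    Set.univ (u (k + 1) t)
  y_step : ∀ k t, y (k + 1) t = y k t + rho • (w (k + 1) t - u (k + 1) t)

/-- `v^k = min_{0 ≤ l ≤ k} (∑ₜ ‖wₜ^{l+1} - wₜ^l‖₂² + ∑ₜ ‖uₜ^{l+1} - uₜ^l‖₂²)`. -/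
def minStep {T d : ℕ} (w u : ℕ → Stack T d) (k : ℕ) : ℝ :=
  (Finset.range (k + 1)).inf' Finset.nonempty_range_add_one
    (fun l => (∑ t, ‖w (l + 1) t - w l t‖ ^ 2) + ∑ t, ‖u (l + 1) t - u l t‖ ^ 2)

end

end SRML

/-! Put g_t(x) = ℒ_t(x) + μ‖x‖². It is nonnegative and convex, and ρ > 2(H + 2μ) makes it
ρ/2-smooth.

Optimality of the w-update reads ∇g_t(w^{k+1}) + y^k + ρ(w^{k+1} - u^k) = 0. Two consecutive such
equations and the dual update eliminate y: w^{k+2} = u^{k+1} + (u^{k+1} - u^k) - θ, where ρθ =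
∇g_t(w^{k+2}) - ∇g_t(w^{k+1}).

The slack is not jointly convex, but each of its products couples two different blocks, so every
u-subproblem is ρ-strongly convex. The decreases telescope over the sweep. With y eliminated and R
the nonsmooth part, this is `IsMiADMM.regularizer_le`: R drops by at least Σ_t (⟨∇g_t(w_t), Δu_t⟩ +
ρ‖Δu_t‖²).

Add to R(u) the linearization of g_t at w_t evaluated at u_t, plus ρ times a quadratic form in u_t -
w_t and Δu_t. Cocoercivity of ∇g_t makes this Lyapunov function decrease by a multiple of the
squared step (`SmoothConvex.lyapunov_step`), and smoothness keeps it nonnegative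
(`SmoothConvex.lyapunov_ge`). Hence the squared steps are summable, and their running minimum is
o(1/k). -/

namespace SRML

/-! ### Smooth convex functions and the one-block Lyapunov inequality. -/

section SmoothConvexFunctions

variable {E : Type*} [NormedAddCommGroup E] [InnerProductSpace ℝ E]

/-- `g` is convex and `K`-smooth, with gradient `G`, expressed by the two quadratic bounds on the
Bregman divergence of `g`. -/
def SmoothConvex (K : ℝ) (g : E → ℝ) (G : E → E) : Prop :=
  ∀ v w, 0 ≤ g v - g w - inner ℝ (G w) (v - w) ∧
    g v - g w - inner ℝ (G w) (v - w) ≤ K / 2 * ‖v - w‖ ^ 2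

theorem SmoothConvex.mono {K K' : ℝ} {g : E → ℝ} {G : E → E} (h : SmoothConvex K g G)
    (hK : K ≤ K') : SmoothConvex K' g G := fun v w =>
  ⟨(h v w).1, (h v w).2.trans (by gcongr)⟩

theorem SmoothConvex.add_sq {K mu : ℝ} {g : E → ℝ} {G : E → E} (h : SmoothConvex K g G)
    (hmu : 0 ≤ mu) :
    SmoothConvex (K + 2 * mu) (fun x => g x + mu * ‖x‖ ^ 2) (fun x => G x + (2 * mu) • x) := by
  intro v w
  have key : (g v + mu * ‖v‖ ^ 2) - (g w + mu * ‖w‖ ^ 2)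
      - inner ℝ (G w + (2 * mu) • w) (v - w)
      = (g v - g w - inner ℝ (G w) (v - w)) + mu * ‖v - w‖ ^ 2 := by
    rw [inner_add_left, inner_smul_left, inner_sub_right w, norm_sub_sq_real,
      real_inner_self_eq_norm_sq, real_inner_comm w v]
    simp only [conj_trivial]
    ring
  have hn : 0 ≤ mu * ‖v - w‖ ^ 2 := by positivity
  have := h v w
  simp only [key]
  constructor
  · linarith [this.1]
  · linarith [this.2]

/-- The Bregman divergence dominates the squared distance of the gradients. -/
theorem SmoothConvex.norm_sub_sq_le {K : ℝ} {g : E → ℝ} {G : E → E} (h : SmoothConvex K g G)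
    (hK : 0 < K) (v w : E) :
    1 / (2 * K) * ‖G v - G w‖ ^ 2 ≤ g v - g w - inner ℝ (G w) (v - w) := by
  set q := G v - G w with hq
  -- By convexity, w minimizes x ↦ g x - ⟨G w, x⟩. A gradient step of length 1/K from v lowers this
  -- function by at least ‖q‖²/(2K), and not below its value at w.
  have h1 := (h (v - (1 / K) • q) w).1
  have h2 := (h (v - (1 / K) • q) v).2
  have e1 : v - (1 / K) • q - v = -((1 / K) • q) := by abel
  have e2 : v - (1 / K) • q - w = (v - w) - (1 / K) • q := by abel
  rw [e1, inner_neg_right, norm_neg, norm_smul, inner_smul_right] at h2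
  rw [e2, inner_sub_right, inner_smul_right] at h1
  have e3 : inner ℝ (G v) q - inner ℝ (G w) q = ‖q‖ ^ 2 := by
    rw [← inner_sub_left, ← hq, real_inner_self_eq_norm_sq]
  have e4 : K / 2 * (‖1 / K‖ * ‖q‖) ^ 2 = 1 / (2 * K) * ‖q‖ ^ 2 := by
    rw [Real.norm_of_nonneg (by positivity)]
    field_simp
  have e5 : 1 / K * inner ℝ (G v) q = 1 / K * inner ℝ (G w) q + 1 / K * ‖q‖ ^ 2 := by
    rw [← e3]; ring
  have e6 : 1 / K * ‖q‖ ^ 2 = 2 * (1 / (2 * K) * ‖q‖ ^ 2) := by field_simp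
  linarith

/-- Cocoercivity of the gradient: the sum of the previous bound and its copy with v and w exchanged.
-/
theorem SmoothConvex.inner_sub_ge {K : ℝ} {g : E → ℝ} {G : E → E} (h : SmoothConvex K g G)
    (hK : 0 < K) (v w : E) :
    1 / K * ‖G v - G w‖ ^ 2 ≤ inner ℝ (G v - G w) (v - w) := by
  have h1 := h.norm_sub_sq_le hK v w
  have h2 := h.norm_sub_sq_le hK w v
  rw [norm_sub_rev (G w), ← neg_sub v w, inner_neg_right] at h2
  rw [inner_sub_left]
  have e : 1 / K * ‖G v - G w‖ ^ 2 = 2 * (1 / (2 * K) * ‖G v - G w‖ ^ 2) := by field_simp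
  linarith

/-- First order optimality condition of the proximal step. -/
theorem SmoothConvex.gradient_eq_zero {K rho : ℝ} {g : E → ℝ} {G : E → E}
    (h : SmoothConvex K g G) (hK : 0 ≤ K) (hrho : 0 < rho) {b a x : E}
    (hmin : ∀ z, g x + inner ℝ b (x - a) + rho / 2 * ‖x - a‖ ^ 2
      ≤ g z + inner ℝ b (z - a) + rho / 2 * ‖z - a‖ ^ 2) :
    G x + b + rho • (x - a) = 0 := by
  set v := G x + b + rho • (x - a) with hv
  set s := 1 / (K + rho) with hs
  -- The proximal objective is (K + ρ)-smooth with gradient v at x, so a gradient step of length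
  -- 1/(K + ρ) would strictly decrease it unless v = 0.
  have h1 := hmin (x - s • v)
  have h2 := (h (x - s • v) x).2
  have e1 : x - s • v - x = -(s • v) := by abel
  have e2 : x - s • v - a = (x - a) - s • v := by abel
  rw [e1, inner_neg_right, norm_neg, norm_smul, inner_smul_right, mul_pow, Real.norm_eq_abs,
    sq_abs] at h2
  rw [e2, inner_sub_right b (x - a), inner_smul_right, norm_sub_sq_real (x - a),
    inner_smul_right, norm_smul, mul_pow, Real.norm_eq_abs, sq_abs] at h1
  have e3 : inner ℝ (G x) v + inner ℝ b v + rho * inner ℝ (x - a) v = ‖v‖ ^ 2 := by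
    rw [← real_inner_self_eq_norm_sq v]
    nth_rw 4 [hv]
    rw [inner_add_left, inner_add_left, inner_smul_left, conj_trivial]
  have h3 : s * ‖v‖ ^ 2 ≤ (K + rho) / 2 * (s ^ 2 * ‖v‖ ^ 2) := by
    have e5 := congrArg (s * ·) e3
    linarith
  have e4 : (K + rho) / 2 * (s ^ 2 * ‖v‖ ^ 2) = s / 2 * ‖v‖ ^ 2 := by
    rw [hs]; field_simp
  have hs0 : 0 < s := by positivity
  have h4 : s * ‖v‖ ^ 2 ≤ 0 := by linarith
  have h5 : ‖v‖ ^ 2 ≤ 0 := by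
    by_contra hc
    push Not at hc
    linarith [mul_pos hs0 hc]
  simpa using h5

/-- The quadratic form inequality behind the decrease of the Lyapunov function. -/
theorem lyapunov_form_le (D' θ D r : E) (h : 3 * ‖θ‖ ^ 2 ≤ inner ℝ θ (D + r)) :
    -‖D'‖ ^ 2 - ‖θ‖ ^ 2 + inner ℝ θ r
      + (1 / 2 * ‖D' - D + θ‖ ^ 2 + ‖D'‖ ^ 2 - 4 / 5 * inner ℝ D' (D' - D + θ))
      + 1 / 25 * (‖D'‖ ^ 2 + ‖θ‖ ^ 2 + ‖D‖ ^ 2 + ‖r‖ ^ 2)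
      ≤ 1 / 2 * ‖r‖ ^ 2 + ‖D‖ ^ 2 - 4 / 5 * inner ℝ D r := by
  -- Add 1/4 of the slack in `h` and complete squares in D', then θ, then D; a negative multiple of
  -- ‖r‖² remains.
  have s1 := sq_nonneg ‖D' - (5 / 13 : ℝ) • θ + (5 / 13 : ℝ) • D‖
  have s2 := sq_nonneg ‖θ + (1075 / 3046 : ℝ) • D - (1625 / 3046 : ℝ) • r‖
  have s3 := sq_nonneg ‖D - (36435 / 55969 : ℝ) • r‖
  have s4 := sq_nonneg ‖r‖
  simp only [← real_inner_self_eq_norm_sq, inner_add_left, inner_add_right, inner_sub_left,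
    inner_sub_right, inner_smul_left, inner_smul_right, conj_trivial] at *
  rw [real_inner_comm D' θ, real_inner_comm D' D, real_inner_comm θ D, real_inner_comm θ r,
    real_inner_comm D r] at *
  linarith

theorem norm_sq_div_four_le_lyapunov_form (D r : E) :
    1 / 4 * ‖r‖ ^ 2 ≤ 1 / 2 * ‖r‖ ^ 2 + ‖D‖ ^ 2 - 4 / 5 * inner ℝ D r := by
  have s1 := sq_nonneg ‖D - (2 / 5 : ℝ) • r‖
  have s4 := sq_nonneg ‖r‖
  simp only [← real_inner_self_eq_norm_sq, inner_sub_left,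
    inner_sub_right, inner_smul_left, inner_smul_right, conj_trivial] at *
  rw [real_inner_comm D r] at *
  linarith

/-- One step of the inertial proximal gradient form of ADMM, for the smooth part. -/
theorem SmoothConvex.lyapunov_step {rho : ℝ} {g : E → ℝ} {G : E → E}
    (h : SmoothConvex (rho / 2) g G) (hrho : 0 < rho) {w w' u₀ u u' : E}
    (hw : G w' - G w + rho • (w' - u - (u - u₀)) = 0) :
    (g w' + inner ℝ (G w') (u' - w') + rho * (1 / 2 * ‖u' - w'‖ ^ 2 + ‖u' - u‖ ^ 2
        - 4 / 5 * inner ℝ (u' - u) (u' - w')))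
      - inner ℝ (G w') (u' - u) - rho * ‖u' - u‖ ^ 2
      + rho / 100 * (‖w' - w‖ ^ 2 + ‖u' - u‖ ^ 2)
      ≤ g w + inner ℝ (G w) (u - w) + rho * (1 / 2 * ‖u - w‖ ^ 2 + ‖u - u₀‖ ^ 2
        - 4 / 5 * inner ℝ (u - u₀) (u - w)) := by
  obtain ⟨θ, hθ⟩ : ∃ θ : E, G w' - G w = rho • θ :=
    ⟨rho⁻¹ • (G w' - G w), by rw [smul_smul, mul_inv_cancel₀ hrho.ne', one_smul]⟩
  have hw' : w' = u + (u - u₀) - θ := by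
    rw [hθ, ← smul_add, smul_eq_zero] at hw
    rcases hw with hw | hw
    · exact absurd hw hrho.ne'
    · rw [← sub_eq_zero, ← hw]; abel
  -- Here D = u - u₀ and r = u - w. The Bregman bound supplies the term -‖θ‖² of the quadratic form,
  -- cocoercivity its hypothesis: w' - w = D + r - θ turns 2‖θ‖² into 3‖θ‖².
  have h1 := h.norm_sub_sq_le (by positivity) w w'
  have h2 := h.inner_sub_ge (by positivity) w' w
  rw [norm_sub_rev, hθ, norm_smul, mul_pow, Real.norm_eq_abs, sq_abs] at h1
  rw [hθ, norm_smul, mul_pow, Real.norm_eq_abs, sq_abs, inner_smul_left] at h2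
  have e1 : 1 / (2 * (rho / 2)) * (rho ^ 2 * ‖θ‖ ^ 2) = rho * ‖θ‖ ^ 2 := by field_simp
  have e2 : 1 / (rho / 2) * (rho ^ 2 * ‖θ‖ ^ 2) = rho * (2 * ‖θ‖ ^ 2) := by field_simp
  rw [e1] at h1
  simp only [e2, conj_trivial] at h2
  have h3 : 2 * ‖θ‖ ^ 2 ≤ inner ℝ θ (w' - w) := le_of_mul_le_mul_left h2 hrho
  have e3 : w' - w = ((u - u₀) + (u - w)) - θ := by rw [hw']; abel
  have e4 : u' - w' = (u' - u) - (u - u₀) + θ := by rw [hw']; abel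
  have h4 : 3 * ‖θ‖ ^ 2 ≤ inner ℝ θ ((u - u₀) + (u - w)) := by
    rw [e3, inner_sub_right, real_inner_self_eq_norm_sq] at h3
    linarith
  have h5 := mul_le_mul_of_nonneg_left (lyapunov_form_le (u' - u) θ (u - u₀) (u - w) h4) hrho.le
  -- The factor 3 fits the margin 1/25 = 4/100: 3/100 pays for the w-step and 1/100 for the u-step.
  have h6 : ‖w' - w‖ ^ 2 ≤ 3 * (‖u - u₀‖ ^ 2 + ‖u - w‖ ^ 2 + ‖θ‖ ^ 2) := by
    have : ‖w' - w‖ ≤ ‖u - u₀‖ + ‖u - w‖ + ‖θ‖ := by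
      rw [e3]; exact (norm_sub_le _ _).trans (by gcongr; exact norm_add_le _ _)
    have h7 := pow_le_pow_left₀ (norm_nonneg _) this 2
    nlinarith [sq_nonneg (‖u - u₀‖ - ‖u - w‖), sq_nonneg (‖u - w‖ - ‖θ‖),
      sq_nonneg (‖u - u₀‖ - ‖θ‖)]
  have h6' := mul_le_mul_of_nonneg_left h6 hrho.le
  have e5 : inner ℝ (G w') (u' - w') - inner ℝ (G w') (u' - u) - inner ℝ (G w) (u - w)
      + inner ℝ (G w') (w' - w) = rho * inner ℝ θ (u - w) := by
    have : rho * inner ℝ θ (u - w) = inner ℝ (G w' - G w) (u - w) := by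
      rw [hθ, inner_smul_left]; simp
    rw [this]
    simp only [inner_sub_left, inner_sub_right]
    ring
  rw [← neg_sub w' w, inner_neg_right] at h1
  rw [← e4] at h5
  have hD : 0 ≤ rho * ‖u' - u‖ ^ 2 := by positivity
  have hT : 0 ≤ rho * (‖u - u₀‖ ^ 2 + ‖u - w‖ ^ 2 + ‖θ‖ ^ 2) := by positivity
  linarith

/-- The descent lemma gives g u ≤ g w + ⟨G w, u - w⟩ + ρ/4 ‖u - w‖², and the quadratic form
dominates the last term. -/
theorem SmoothConvex.lyapunov_ge {rho : ℝ} {g : E → ℝ} {G : E → E}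
    (h : SmoothConvex (rho / 2) g G) (hrho : 0 < rho) (hg : ∀ x, 0 ≤ g x) (w D u : E) :
    0 ≤ g w + inner ℝ (G w) (u - w) + rho * (1 / 2 * ‖u - w‖ ^ 2 + ‖D‖ ^ 2
        - 4 / 5 * inner ℝ D (u - w)) := by
  have h1 := (h u w).2
  have h2 := mul_le_mul_of_nonneg_left (norm_sq_div_four_le_lyapunov_form D (u - w)) hrho.le
  linarith [hg u]

end SmoothConvexFunctions

/-! ### Summability and running minima. -/

section Sequences

/-- Running minima of a summable nonnegative sequence are `o(1/k)`. -/
theorem isLittleO_of_le_summable {v S : ℕ → ℝ} (hv0 : ∀ k, 0 ≤ v k)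
    (hvS : ∀ k l, l ≤ k → v k ≤ S l) (hS : Summable S) :
    v =o[atTop] (fun k : ℕ => 1 / (k : ℝ)) := by
  have hlim := hS.hasSum.tendsto_sum_nat
  have hhalf : Tendsto (fun k : ℕ => k / 2) atTop atTop :=
    Nat.tendsto_div_const_atTop two_ne_zero
  -- Each of the at least k/2 terms with index in [k/2, k) is at least `v k`, so k · `v k` is at
  -- most twice a block sum that vanishes by the Cauchy property.
  have hdiff : Tendsto (fun k : ℕ => 2 * (∑ l ∈ Finset.range k, S l
      - ∑ l ∈ Finset.range (k / 2), S l)) atTop (nhds 0) := by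
    simpa using (hlim.sub (hlim.comp hhalf)).const_mul 2
  have hle : ∀ k : ℕ, (k : ℝ) * v k ≤ 2 * (∑ l ∈ Finset.range k, S l
      - ∑ l ∈ Finset.range (k / 2), S l) := by
    intro k
    rw [← Finset.sum_Ico_eq_sub _ (Nat.div_le_self k 2)]
    have h1 : ((k - k / 2 : ℕ) : ℝ) * v k ≤ ∑ l ∈ Finset.Ico (k / 2) k, S l := by
      rw [← nsmul_eq_mul, ← Nat.card_Ico]
      exact Finset.card_nsmul_le_sum _ _ _ fun l hl => hvS k l (Finset.mem_Ico.1 hl).2.le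
    have h2 : (k : ℝ) ≤ 2 * ((k - k / 2 : ℕ) : ℝ) := by
      have : k ≤ 2 * (k - k / 2) := by omega
      exact_mod_cast this
    nlinarith [mul_le_mul_of_nonneg_right h2 (hv0 k)]
  have hk : Tendsto (fun k : ℕ => (k : ℝ) * v k) atTop (nhds 0) :=
    squeeze_zero (fun k => mul_nonneg (Nat.cast_nonneg k) (hv0 k)) hle hdiff
  refine (isLittleO_iff_tendsto' ?_).2 ?_
  · filter_upwards [eventually_ge_atTop 1] with k hk1 h0
    have : (0 : ℝ) < k := by exact_mod_cast hk1
    exact absurd h0 (by positivity)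
  · simpa [mul_comm] using hk

/-- A nonnegative Lyapunov function that decreases by at least `δ S k` makes `S` summable. -/
theorem summable_of_lyapunov {V S : ℕ → ℝ} {δ : ℝ} (hδ : 0 < δ) (hV : ∀ k, 0 ≤ V k)
    (hS : ∀ k, 0 ≤ S k) (hstep : ∀ k, V (k + 1) + δ * S k ≤ V k) : Summable S := by
  have hsum : ∀ n, V n + δ * ∑ k ∈ Finset.range n, S k ≤ V 0 := by
    intro n
    induction n with
    | zero => simp
    | succ n ih =>
      rw [Finset.sum_range_succ]
      linarith [hstep n]
  refine summable_of_sum_range_le (c := V 0 / δ) hS fun n => ?_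
  rw [le_div_iff₀ hδ]
  linarith [hsum n, hV n]

end Sequences

end SRML

namespace SRML

/-! ### Block updates of the augmented Lagrangian and the Lyapunov argument. -/

section AugmentedLagrangian

variable {T d : ℕ}

theorem sum_sweep_sub (φ : Fin T → EuclideanSpace ℝ (Fin d) → ℝ) (new old : Stack T d)
    (t : Fin T) (x z : EuclideanSpace ℝ (Fin d)) :
    ∑ s, φ s (sweep new old t x s) - ∑ s, φ s (sweep new old t z s) = φ t x - φ t z := by
  rw [← Finset.sum_sub_distrib, Finset.sum_eq_single t]
  · simp [sweep]
  · intro s _ hs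
    simp [sweep, hs]
  · simp

theorem augLagrangian_sweep_sub (loss : Fin T → EuclideanSpace ℝ (Fin d) → ℝ)
    (mu lam c rho : ℝ) (new old u y : Stack T d) (t : Fin T) (x z : EuclideanSpace ℝ (Fin d)) :
    augLagrangian loss mu lam c rho (sweep new old t x) u y
      - augLagrangian loss mu lam c rho (sweep new old t z) u y
      = ((loss t x + mu * ‖x‖ ^ 2) + inner ℝ (y t) (x - u t) + rho / 2 * ‖x - u t‖ ^ 2)
      - ((loss t z + mu * ‖z‖ ^ 2) + inner ℝ (y t) (z - u t) + rho / 2 * ‖z - u t‖ ^ 2) := by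
  have h1 := sum_sweep_sub (fun s x => loss s x + mu * ‖x‖ ^ 2) new old t x z
  have h2 := sum_sweep_sub (fun s x => inner ℝ (y s) (x - u s)) new old t x z
  have h3 := congrArg (rho / 2 * ·) (sum_sweep_sub (fun s x => ‖x - u s‖ ^ 2) new old t x z)
  beta_reduce at h1 h2 h3
  unfold augLagrangian
  linarith

theorem slack_nonneg (u : Stack T d) : 0 ≤ slack u := by
  refine Finset.sum_nonneg fun t _ => Finset.sum_nonneg fun s _ => ?_
  split_ifs
  · exact Finset.sum_nonneg fun j _ => le_max_left _ _
  · exact le_rfl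

/-- The slack term is convex in every single block. -/
theorem slack_convex_comb {P R Z : Stack T d} {t : Fin T} {a b : ℝ} (ha : 0 ≤ a) (hb : 0 ≤ b)
    (hab : a + b = 1) (hPR : ∀ s, s ≠ t → P s = R s) (hZ : ∀ s, Z s = a • P s + b • R s) :
    slack Z ≤ a * slack P + b * slack R := by
  unfold slack
  simp only [Finset.mul_sum]
  rw [← Finset.sum_add_distrib]
  refine Finset.sum_le_sum fun q _ => ?_
  rw [← Finset.sum_add_distrib]
  refine Finset.sum_le_sum fun s _ => ?_
  split_ifs with hs
  · rw [Finset.mul_sum, Finset.mul_sum, ← Finset.sum_add_distrib]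
    refine Finset.sum_le_sum fun j _ => ?_
    -- Consecutive tasks are distinct, so one factor of the product is fixed and the product is
    -- affine in block t.
    have hne : q ≠ t ∨ s ≠ t := by
      by_contra! h
      rw [h.1, h.2] at hs
      omega
    have hmul : Z q j * Z s j = a * (P q j * P s j) + b * (R q j * R s j) := by
      rw [hZ, hZ]
      simp only [PiLp.add_apply, PiLp.smul_apply, smul_eq_mul]
      obtain rfl : b = 1 - a := by linarith
      rcases hne with h | h
      · rw [hPR q h]; ring
      · rw [hPR s h]; ring
    rw [hmul]
    refine max_le (by positivity) ?_
    have h1 := mul_le_mul_of_nonneg_left (le_max_right 0 (-(P q j * P s j))) ha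
    have h2 := mul_le_mul_of_nonneg_left (le_max_right 0 (-(R q j * R s j))) hb
    linarith
  · simp

/-- The augmented Lagrangian is `ρ`-strongly convex in every single block of `u`. -/
theorem augLagrangian_convex_comb (loss : Fin T → EuclideanSpace ℝ (Fin d) → ℝ)
    {mu lam c rho : ℝ} (hlam : 0 ≤ lam) (hc : 0 ≤ c) (hrho : 0 ≤ rho) (w y : Stack T d)
    {P R Z : Stack T d} {t : Fin T} {a b : ℝ} (ha : 0 ≤ a) (hb : 0 ≤ b)
    (hab : a + b = 1) (hPR : ∀ s, s ≠ t → P s = R s) (hZ : ∀ s, Z s = a • P s + b • R s) :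
    augLagrangian loss mu lam c rho w Z y
      ≤ a * augLagrangian loss mu lam c rho w P y + b * augLagrangian loss mu lam c rho w R y
        - a * b * (rho / 2 * ‖P t - R t‖ ^ 2) := by
  have h1 := mul_le_mul_of_nonneg_left (slack_convex_comb ha hb hab hPR hZ) hc
  have h2 : ∑ s, ∑ j, |Z s j| ≤ a * ∑ s, ∑ j, |P s j| + b * ∑ s, ∑ j, |R s j| := by
    simp only [Finset.mul_sum]
    rw [← Finset.sum_add_distrib]
    refine Finset.sum_le_sum fun s _ => ?_
    rw [← Finset.sum_add_distrib]
    refine Finset.sum_le_sum fun j _ => ?_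
    rw [hZ]
    simp only [PiLp.add_apply, PiLp.smul_apply, smul_eq_mul]
    refine (abs_add_le _ _).trans ?_
    rw [abs_mul, abs_mul, abs_of_nonneg ha, abs_of_nonneg hb]
  have h2' := mul_le_mul_of_nonneg_left h2 hlam
  have hw : ∀ s, w s - Z s = a • (w s - P s) + b • (w s - R s) := by
    intro s
    rw [hZ, smul_sub, smul_sub]
    have : w s = a • w s + b • w s := by rw [← add_smul, hab, one_smul]
    nth_rw 1 [this]
    abel
  have h3 : ∑ s, inner ℝ (y s) (w s - Z s)
      = a * ∑ s, inner ℝ (y s) (w s - P s) + b * ∑ s, inner ℝ (y s) (w s - R s) := by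
    rw [Finset.mul_sum, Finset.mul_sum, ← Finset.sum_add_distrib]
    refine Finset.sum_congr rfl fun s _ => ?_
    rw [hw, inner_add_right, inner_smul_right, inner_smul_right]
  have h4 : ∑ s, ‖w s - Z s‖ ^ 2 = a * ∑ s, ‖w s - P s‖ ^ 2 + b * ∑ s, ‖w s - R s‖ ^ 2
      - a * b * ∑ s, ‖P s - R s‖ ^ 2 := by
    rw [Finset.mul_sum, Finset.mul_sum, Finset.mul_sum, ← Finset.sum_add_distrib,
      ← Finset.sum_sub_distrib]
    refine Finset.sum_congr rfl fun s _ => ?_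
    have e : P s - R s = (w s - R s) - (w s - P s) := by abel
    rw [hw, e, norm_add_sq_real, norm_sub_sq_real (w s - R s), norm_smul, norm_smul, mul_pow, mul_pow,
      Real.norm_eq_abs, Real.norm_eq_abs, sq_abs, sq_abs, inner_smul_left, inner_smul_right,
      real_inner_comm (w s - P s) (w s - R s), conj_trivial]
    obtain rfl : b = 1 - a := by linarith
    ring
  have h5 : ‖P t - R t‖ ^ 2 ≤ ∑ s, ‖P s - R s‖ ^ 2 :=
    Finset.single_le_sum (f := fun s => ‖P s - R s‖ ^ 2) (fun s _ => by positivity)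
      (Finset.mem_univ t)
  have h6 : a * b * (rho / 2) * ‖P t - R t‖ ^ 2 ≤ a * b * (rho / 2) * ∑ s, ‖P s - R s‖ ^ 2 := by
    gcongr
  unfold augLagrangian
  rw [h3, h4]
  obtain rfl : b = 1 - a := by linarith
  linarith

/-- Quadratic growth of a strongly convex block at its minimizer. -/
theorem augLagrangian_growth (loss : Fin T → EuclideanSpace ℝ (Fin d) → ℝ)
    {mu lam c rho : ℝ} (hlam : 0 ≤ lam) (hc : 0 ≤ c) (hrho : 0 ≤ rho) (w y new old : Stack T d)
    (t : Fin T) {x : EuclideanSpace ℝ (Fin d)}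
    (hmin : IsMinOn (fun x => augLagrangian loss mu lam c rho w (sweep new old t x) y)
      Set.univ x) (z : EuclideanSpace ℝ (Fin d)) :
    augLagrangian loss mu lam c rho w (sweep new old t x) y + rho / 2 * ‖z - x‖ ^ 2
      ≤ augLagrangian loss mu lam c rho w (sweep new old t z) y := by
  set f := fun x => augLagrangian loss mu lam c rho w (sweep new old t x) y with hf
  set N := rho / 2 * ‖z - x‖ ^ 2 with hN
  have hmin' : ∀ v, f x ≤ f v := fun v => hmin (Set.mem_univ v)
  have hconv : ∀ s : ℝ, 0 < s → s ≤ 1 → (1 - s) * N ≤ f z - f x := by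
    intro s hs0 hs1
    have h := augLagrangian_convex_comb loss (mu := mu) hlam hc hrho w y
      (P := sweep new old t z) (R := sweep new old t x)
      (Z := sweep new old t (s • z + (1 - s) • x)) (t := t) (a := s) (b := 1 - s)
      hs0.le (by linarith) (by ring)
      (fun q hq => by simp [sweep, hq])
      (fun q => by
        by_cases h1 : q < t
        · simp [sweep, h1, ← add_smul]
        · by_cases h2 : q = t
          · simp [sweep, h2]
          · simp [sweep, h1, h2, ← add_smul])
    have ht : ∀ v, sweep new old t v t = v := fun v => by simp [sweep]
    rw [ht, ht] at h
    have h' := (hmin' _).trans h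
    have : s * ((1 - s) * N) ≤ s * (f z - f x) := by
      simp only [hf, hN] at h' ⊢
      linarith
    exact le_of_mul_le_mul_left this hs0
  have hN0 : 0 ≤ N := by positivity
  have hzx : 0 ≤ f z - f x := by linarith [hmin' z]
  suffices N ≤ f z - f x by
    change f x + N ≤ f z
    linarith
  by_contra! hlt
  have hNpos : 0 < N := hzx.trans_lt hlt
  -- In place of the limit s → 0: this s makes (1 - s)N the midpoint of N and f z - f x, which
  -- exceeds f z - f x.
  have h := hconv ((N - (f z - f x)) / (2 * N)) (div_pos (by linarith) (by linarith))
    ((div_le_one (by linarith)).2 (by linarith))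
  have e : (1 - (N - (f z - f x)) / (2 * N)) * N = (N + (f z - f x)) / 2 := by
    field_simp
    ring
  rw [e] at h
  linarith

theorem sum_sweep_telescope (F : Stack T d → ℝ) (new old : Stack T d) :
    ∑ t, (F (sweep new old t (old t)) - F (sweep new old t (new t))) = F old - F new := by
  -- `P n` is the stack after n block updates; updating block t leads from `P t` to `P (t + 1)`.
  let P : ℕ → Stack T d := fun n s => if (s : ℕ) < n then new s else old s
  have h1 : ∀ t : Fin T, sweep new old t (old t) = P t := by
    intro t
    funext s
    by_cases h : s < t
    · simp [sweep, P, h]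
    · by_cases h2 : s = t
      · simp [sweep, P, h2]
      · simp [sweep, P, h, h2]
  have h2 : ∀ t : Fin T, sweep new old t (new t) = P (t + 1) := by
    intro t
    funext s
    by_cases h : s < t
    · have : (s : ℕ) < t + 1 := by omega
      simp [sweep, P, h, this]
    · by_cases h2 : s = t
      · simp [sweep, P, h2]
      · have : ¬ (s : ℕ) < t + 1 := by omega
        simp [sweep, P, h, h2, this]
  simp only [h1, h2]
  rw [Fin.sum_univ_eq_sum_range (fun n => F (P n) - F (P (n + 1))) T, Finset.sum_range_sub']
  congr 2
  funext s
  simp [P]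

variable {loss : Fin T → EuclideanSpace ℝ (Fin d) → ℝ} {mu lam c rho : ℝ}
  {w u y : ℕ → Stack T d}

theorem IsMiADMM.gradient_eq_zero (h : IsMiADMM loss mu lam c rho w u y) {K : ℝ}
    {G : Fin T → EuclideanSpace ℝ (Fin d) → EuclideanSpace ℝ (Fin d)}
    (hG : ∀ t, SmoothConvex K (fun x => loss t x + mu * ‖x‖ ^ 2) (G t)) (hK : 0 ≤ K)
    (hrho : 0 < rho) (k : ℕ) (t : Fin T) :
    G t (w (k + 1) t) + y k t + rho • (w (k + 1) t - u k t) = 0 := by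
  refine (hG t).gradient_eq_zero hK hrho fun z => ?_
  have h1 := augLagrangian_sweep_sub loss mu lam c rho (w (k + 1)) (w k) (u k) (y k) t
    (w (k + 1) t) z
  have h2 : augLagrangian loss mu lam c rho (sweep (w (k + 1)) (w k) t (w (k + 1) t)) (u k) (y k)
      ≤ augLagrangian loss mu lam c rho (sweep (w (k + 1)) (w k) t z) (u k) (y k) :=
    h.w_step k t (Set.mem_univ z)
  linarith

theorem IsMiADMM.augLagrangian_u_le (h : IsMiADMM loss mu lam c rho w u y)
    (hlam : 0 ≤ lam) (hc : 0 ≤ c) (hrho : 0 ≤ rho) (k : ℕ) :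
    augLagrangian loss mu lam c rho (w (k + 1)) (u (k + 1)) (y k)
        + rho / 2 * ∑ t, ‖u (k + 1) t - u k t‖ ^ 2
      ≤ augLagrangian loss mu lam c rho (w (k + 1)) (u k) (y k) := by
  have h1 := sum_sweep_telescope
    (fun v => augLagrangian loss mu lam c rho (w (k + 1)) v (y k)) (u (k + 1)) (u k)
  have h2 : ∑ t, rho / 2 * ‖u (k + 1) t - u k t‖ ^ 2
      ≤ augLagrangian loss mu lam c rho (w (k + 1)) (u k) (y k)
        - augLagrangian loss mu lam c rho (w (k + 1)) (u (k + 1)) (y k) := by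
    rw [← h1]
    refine Finset.sum_le_sum fun t _ => ?_
    have := augLagrangian_growth loss hlam hc hrho (w (k + 1)) (y k) (u (k + 1)) (u k) t
      (h.u_step k t) (u k t)
    rw [norm_sub_rev] at this
    linarith
  rw [← Finset.mul_sum] at h2
  linarith

/-- The nonsmooth part of the objective. -/
def regularizer (lam c : ℝ) (u : Stack T d) : ℝ :=
  lam * ∑ t, ∑ j, |u t j| + c * slack u

theorem regularizer_nonneg (hlam : 0 ≤ lam) (hc : 0 ≤ c) (u : Stack T d) :
    0 ≤ regularizer lam c u :=
  add_nonneg (mul_nonneg hlam (Finset.sum_nonneg fun _ _ => Finset.sum_nonneg fun _ _ =>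
    abs_nonneg _)) (mul_nonneg hc (slack_nonneg u))

/-- The sweep over the blocks of `u` is a proximal gradient step at `u k`, for the gradient of the
smooth part at `w (k + 1)`. -/
theorem IsMiADMM.regularizer_le (h : IsMiADMM loss mu lam c rho w u y)
    (hlam : 0 ≤ lam) (hc : 0 ≤ c) (hrho : 0 < rho) {K : ℝ}
    {G : Fin T → EuclideanSpace ℝ (Fin d) → EuclideanSpace ℝ (Fin d)}
    (hG : ∀ t, SmoothConvex K (fun x => loss t x + mu * ‖x‖ ^ 2) (G t)) (hK : 0 ≤ K) (k : ℕ) :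
    regularizer lam c (u (k + 1)) + ∑ t, (inner ℝ (G t (w (k + 1) t)) (u (k + 1) t - u k t)
        + rho * ‖u (k + 1) t - u k t‖ ^ 2)
      ≤ regularizer lam c (u k) := by
  have h1 := h.augLagrangian_u_le hlam hc hrho.le k
  have h2 : ∑ t, (inner ℝ (G t (w (k + 1) t)) (u (k + 1) t - u k t)
        + rho * ‖u (k + 1) t - u k t‖ ^ 2)
      = ∑ t, inner ℝ (y k t) (w (k + 1) t - u (k + 1) t)
        - ∑ t, inner ℝ (y k t) (w (k + 1) t - u k t)
        + rho / 2 * ∑ t, ‖w (k + 1) t - u (k + 1) t‖ ^ 2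
        - rho / 2 * ∑ t, ‖w (k + 1) t - u k t‖ ^ 2
        + rho / 2 * ∑ t, ‖u (k + 1) t - u k t‖ ^ 2 := by
    simp only [Finset.mul_sum]
    rw [← Finset.sum_sub_distrib, ← Finset.sum_add_distrib, ← Finset.sum_sub_distrib,
      ← Finset.sum_add_distrib]
    refine Finset.sum_congr rfl fun t _ => ?_
    have hg : G t (w (k + 1) t) = -(y k t + rho • (w (k + 1) t - u k t)) := by
      rw [eq_neg_iff_add_eq_zero, ← add_assoc]
      exact h.gradient_eq_zero hG hK hrho k t
    have e : w (k + 1) t - u (k + 1) t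
        = (w (k + 1) t - u k t) - (u (k + 1) t - u k t) := by abel
    rw [hg, e, norm_sub_sq_real (w (k + 1) t - u k t), inner_sub_right (y k t) (w (k + 1) t - u k t), inner_neg_left,
      inner_add_left, inner_smul_left, conj_trivial]
    ring
  rw [h2]
  unfold augLagrangian at h1
  unfold regularizer
  linarith

theorem minStep_le {k l : ℕ} (hl : l ≤ k) :
    minStep w u k
      ≤ (∑ t, ‖w (l + 1) t - w l t‖ ^ 2) + ∑ t, ‖u (l + 1) t - u l t‖ ^ 2 :=
  Finset.inf'_le _ (Finset.mem_range.2 (Nat.lt_succ_of_le hl))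

theorem minStep_nonneg (k : ℕ) : 0 ≤ minStep w u k := by
  unfold minStep
  rw [Finset.le_inf'_iff]
  intro l _
  positivity

/-- The steps of the algorithm are square summable as soon as the smooth part of the objective is
nonnegative, convex, and `ρ/2`-smooth. -/
theorem IsMiADMM.minStep_isLittleO (h : IsMiADMM loss mu lam c rho w u y)
    (hlam : 0 ≤ lam) (hc : 0 ≤ c) (hrho : 0 < rho)
    {G : Fin T → EuclideanSpace ℝ (Fin d) → EuclideanSpace ℝ (Fin d)}
    (hG : ∀ t, SmoothConvex (rho / 2) (fun x => loss t x + mu * ‖x‖ ^ 2) (G t))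
    (hnonneg : ∀ t x, 0 ≤ loss t x + mu * ‖x‖ ^ 2) :
    minStep w u =o[atTop] (fun k : ℕ => 1 / (k : ℝ)) := by
  set S : ℕ → ℝ := fun l =>
    (∑ t, ‖w (l + 1) t - w l t‖ ^ 2) + ∑ t, ‖u (l + 1) t - u l t‖ ^ 2 with hS
  obtain ⟨ψ, hψ⟩ : ∃ ψ : ℕ → Fin T → ℝ, ∀ k t, ψ k t =
    (loss t (w (k + 1) t) + mu * ‖w (k + 1) t‖ ^ 2)
      + inner ℝ (G t (w (k + 1) t)) (u (k + 1) t - w (k + 1) t)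
      + rho * (1 / 2 * ‖u (k + 1) t - w (k + 1) t‖ ^ 2 + ‖u (k + 1) t - u k t‖ ^ 2
        - 4 / 5 * inner ℝ (u (k + 1) t - u k t) (u (k + 1) t - w (k + 1) t)) :=
    ⟨_, fun _ _ => rfl⟩
  -- The index is shifted by one because the start is arbitrary: no optimality condition links w⁰ to
  -- y⁰.
  let V : ℕ → ℝ := fun k => regularizer lam c (u (k + 1)) + ∑ t, ψ k t
  have hS0 : ∀ k, 0 ≤ S k := fun k => by simp only [hS]; positivity
  have hV0 : ∀ k, 0 ≤ V k := fun k =>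
    add_nonneg (regularizer_nonneg hlam hc _) (Finset.sum_nonneg fun t _ => by
      rw [hψ]
      exact (hG t).lyapunov_ge hrho (hnonneg t) _ _ _)
  have hstep : ∀ k, V (k + 1) + rho / 100 * S (k + 1) ≤ V k := by
    intro k
    have h1 := h.regularizer_le hlam hc hrho hG (by positivity) (k + 1)
    have h2 : ∑ t, (ψ (k + 1) t
        - (inner ℝ (G t (w (k + 1 + 1) t)) (u (k + 1 + 1) t - u (k + 1) t)
          + rho * ‖u (k + 1 + 1) t - u (k + 1) t‖ ^ 2)
        + rho / 100 * (‖w (k + 1 + 1) t - w (k + 1) t‖ ^ 2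
          + ‖u (k + 1 + 1) t - u (k + 1) t‖ ^ 2)) ≤ ∑ t, ψ k t := by
      refine Finset.sum_le_sum fun t _ => ?_
      have hw : G t (w (k + 1 + 1) t) - G t (w (k + 1) t)
          + rho • (w (k + 1 + 1) t - u (k + 1) t - (u (k + 1) t - u k t)) = 0 := by
        have g1 := h.gradient_eq_zero hG (by positivity) hrho k t
        have g2 := h.gradient_eq_zero hG (by positivity) hrho (k + 1) t
        rw [h.y_step k t] at g2
        have : G t (w (k + 1 + 1) t) - G t (w (k + 1) t)
            + rho • (w (k + 1 + 1) t - u (k + 1) t - (u (k + 1) t - u k t))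
            = (G t (w (k + 1 + 1) t) + (y k t + rho • (w (k + 1) t - u (k + 1) t))
                + rho • (w (k + 1 + 1) t - u (k + 1) t))
              - (G t (w (k + 1) t) + y k t + rho • (w (k + 1) t - u k t)) := by
          simp only [smul_sub]
          abel
        rw [this, g1, g2, sub_zero]
      have := (hG t).lyapunov_step hrho hw (u' := u (k + 1 + 1) t)
      rw [hψ, hψ]
      linarith
    rw [Finset.sum_add_distrib, Finset.sum_sub_distrib, ← Finset.mul_sum] at h2
    have h3 : S (k + 1) = ∑ t, (‖w (k + 1 + 1) t - w (k + 1) t‖ ^ 2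
        + ‖u (k + 1 + 1) t - u (k + 1) t‖ ^ 2) := Finset.sum_add_distrib.symm
    simp only [V, h3]
    linarith
  have hsum : Summable S := (summable_nat_add_iff 1).1
    (summable_of_lyapunov (by positivity : 0 < rho / 100) hV0 (fun k => hS0 (k + 1)) hstep)
  exact isLittleO_of_le_summable minStep_nonneg (fun k l hl => minStep_le hl) hsum

end AugmentedLagrangian

end SRML

namespace SRML

/-! ### Smoothness and nonnegativity of the two losses. -/

section Losses

/-- A function of one variable with nondecreasing `L`-Lipschitz derivative satisfies the two
quadratic bounds on its Bregman divergence. -/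
theorem bregman_bounds_of_hasDerivAt {f f' : ℝ → ℝ} {L : ℝ} (hf : ∀ x, HasDerivAt f (f' x) x)
    (hmono : Monotone f') (hlip : Monotone fun x => L * x - f' x) (s t : ℝ) :
    0 ≤ f t - f s - f' s * (t - s) ∧ f t - f s - f' s * (t - s) ≤ L / 2 * (t - s) ^ 2 := by
  have tangent : ∀ {g g' : ℝ → ℝ}, (∀ x, HasDerivAt g (g' x) x) → Monotone g' →
      0 ≤ g t - g s - g' s * (t - s) := by
    intro g g' hg hg'
    have hcont : Continuous g := continuous_iff_continuousAt.2 fun x => (hg x).continuousAt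
    rcases lt_trichotomy s t with h | h | h
    · obtain ⟨x, hx, hxe⟩ := exists_hasDerivAt_eq_slope g g' h hcont.continuousOn
        fun x _ => hg x
      rw [eq_div_iff (by linarith)] at hxe
      nlinarith [hg' hx.1.le]
    · simp [h]
    · obtain ⟨x, hx, hxe⟩ := exists_hasDerivAt_eq_slope g g' h hcont.continuousOn
        fun x _ => hg x
      rw [eq_div_iff (by linarith)] at hxe
      nlinarith [hg' hx.2.le]
  refine ⟨tangent hf hmono, ?_⟩
  -- The upper bound is the tangent inequality for L/2 x² - f, whose derivative is monotone by
  -- `hlip`.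
  have hq : ∀ x, HasDerivAt (fun x => L / 2 * x ^ 2 - f x) (L * x - f' x) x := fun x =>
    (((hasDerivAt_pow 2 x).const_mul (L / 2)).sub (hf x)).congr_deriv (by push_cast; ring)
  have := tangent hq hlip
  nlinarith

theorem bregman_bounds_square (Y s t : ℝ) :
    0 ≤ (Y - t) ^ 2 - (Y - s) ^ 2 - (2 * (s - Y)) * (t - s) ∧
      (Y - t) ^ 2 - (Y - s) ^ 2 - (2 * (s - Y)) * (t - s) ≤ 2 / 2 * (t - s) ^ 2 := by
  constructor <;> nlinarith [sq_nonneg (t - s)]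

theorem hasDerivAt_log_sigmoid (x : ℝ) :
    HasDerivAt (fun x => Real.log (Real.sigmoid x)) (1 - Real.sigmoid x) x := by
  convert (Real.hasDerivAt_sigmoid x).log (Real.sigmoid_pos x).ne' using 1
  field_simp [(Real.sigmoid_pos x).ne']

/-- The cruder bound σ' ≤ 1, instead of the sharp 1/4, suffices: it matches the constant in
`Hclass`. -/
theorem monotone_sub_sigmoid : Monotone fun x => 1 * x - Real.sigmoid x := by
  have hd : ∀ x, HasDerivAt (fun x => 1 * x - Real.sigmoid x)
      (1 * 1 - Real.sigmoid x * (1 - Real.sigmoid x)) x := fun x =>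
    ((hasDerivAt_id x).const_mul 1).sub (Real.hasDerivAt_sigmoid x)
  refine monotone_of_deriv_nonneg (fun x => (hd x).differentiableAt) fun x => ?_
  rw [(hd x).deriv]
  nlinarith [Real.sigmoid_pos x, Real.sigmoid_lt_one x]

theorem bregman_bounds_logistic (Y s t : ℝ) :
    0 ≤ (-(Y * Real.log (Real.sigmoid t)) - (1 - Y) * Real.log (Real.sigmoid (-t)))
        - (-(Y * Real.log (Real.sigmoid s)) - (1 - Y) * Real.log (Real.sigmoid (-s)))
        - (Real.sigmoid s - Y) * (t - s) ∧
      (-(Y * Real.log (Real.sigmoid t)) - (1 - Y) * Real.log (Real.sigmoid (-t)))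
        - (-(Y * Real.log (Real.sigmoid s)) - (1 - Y) * Real.log (Real.sigmoid (-s)))
        - (Real.sigmoid s - Y) * (t - s) ≤ 1 / 2 * (t - s) ^ 2 := by
  refine bregman_bounds_of_hasDerivAt
    (f := fun t => -(Y * Real.log (Real.sigmoid t)) - (1 - Y) * Real.log (Real.sigmoid (-t)))
    (f' := fun s => Real.sigmoid s - Y) (fun x => ?_) ?_ ?_ s t
  · have h1 := ((hasDerivAt_log_sigmoid x).const_mul Y).neg
    have h2 := ((hasDerivAt_log_sigmoid (-x)).comp x (hasDerivAt_neg x)).const_mul (1 - Y)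
    refine (h1.sub h2).congr_deriv ?_
    rw [Real.sigmoid_neg]
    ring
  · exact fun a b hab => sub_le_sub_right (Real.sigmoid_monotone hab) Y
  · intro a b hab
    have := monotone_sub_sigmoid hab
    simp only at this ⊢
    linarith

variable {m d : ℕ}

theorem predict_eq_inner (X : Matrix (Fin m) (Fin d) ℝ) (j : Fin m)
    (w : EuclideanSpace ℝ (Fin d)) : predict X j w = inner ℝ (WithLp.toLp 2 (X j)) w := by
  simp [predict, PiLp.inner_apply, mul_comm]

theorem predict_sub (X : Matrix (Fin m) (Fin d) ℝ) (j : Fin m)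
    (v w : EuclideanSpace ℝ (Fin d)) : predict X j (v - w) = predict X j v - predict X j w := by
  simp only [predict_eq_inner, inner_sub_right]

/-- Sums of smooth convex functions of the linear predictions are smooth and convex. -/
theorem smoothConvex_sum_predict (X : Matrix (Fin m) (Fin d) ℝ) {φ φ' : Fin m → ℝ → ℝ}
    {L a K : ℝ} (ha : 0 ≤ a)
    (hφ : ∀ j s t, 0 ≤ φ j t - φ j s - φ' j s * (t - s) ∧
      φ j t - φ j s - φ' j s * (t - s) ≤ L / 2 * (t - s) ^ 2)
    (hK : ∀ z, a * (L * ∑ j, predict X j z ^ 2) ≤ K * ‖z‖ ^ 2) :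
    SmoothConvex K (fun w => a * ∑ j, φ j (predict X j w))
      (fun w => a • ∑ j, φ' j (predict X j w) • WithLp.toLp 2 (X j)) := by
  intro v w
  have key : a * ∑ j, φ j (predict X j v) - a * ∑ j, φ j (predict X j w)
      - inner ℝ (a • ∑ j, φ' j (predict X j w) • WithLp.toLp 2 (X j)) (v - w)
      = a * ∑ j, (φ j (predict X j v) - φ j (predict X j w)
        - φ' j (predict X j w) * (predict X j v - predict X j w)) := by
    rw [Finset.sum_sub_distrib, Finset.sum_sub_distrib, inner_smul_left, sum_inner, conj_trivial,
      mul_sub, mul_sub]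
    congr 2
    refine Finset.sum_congr rfl fun j _ => ?_
    rw [inner_smul_left, ← predict_eq_inner, predict_sub, conj_trivial]
  simp only [key]
  constructor
  · exact mul_nonneg ha (Finset.sum_nonneg fun j _ => (hφ j _ _).1)
  · have h1 : ∑ j, (φ j (predict X j v) - φ j (predict X j w)
        - φ' j (predict X j w) * (predict X j v - predict X j w))
        ≤ L / 2 * ∑ j, predict X j (v - w) ^ 2 := by
      rw [Finset.mul_sum]
      refine Finset.sum_le_sum fun j _ => ?_
      rw [predict_sub]
      exact (hφ j _ _).2
    have h2 := mul_le_mul_of_nonneg_left h1 ha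
    have h3 := hK (v - w)
    linarith

theorem sum_predict_sq_le (X : Matrix (Fin m) (Fin d) ℝ) (z : EuclideanSpace ℝ (Fin d)) :
    ∑ j, predict X j z ^ 2 ≤ ‖Matrix.toEuclideanCLM (𝕜 := ℝ) (X.transpose * X)‖ * ‖z‖ ^ 2 := by
  have h1 : ∑ j, predict X j z ^ 2
      = inner ℝ z (Matrix.toEuclideanCLM (𝕜 := ℝ) (X.transpose * X) z) := by
    have e1 : ∀ j, predict X j z = X.mulVec z.ofLp j := fun j => rfl
    rw [EuclideanSpace.inner_eq_star_dotProduct, Matrix.ofLp_toEuclideanCLM, star_trivial,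
      dotProduct_comm, ← Matrix.mulVec_mulVec, Matrix.dotProduct_mulVec,
      Matrix.vecMul_transpose]
    simp only [e1, dotProduct, sq]
  rw [h1]
  calc _ ≤ ‖z‖ * ‖Matrix.toEuclideanCLM (𝕜 := ℝ) (X.transpose * X) z‖ :=
        real_inner_le_norm _ _
    _ ≤ ‖z‖ * (‖Matrix.toEuclideanCLM (𝕜 := ℝ) (X.transpose * X)‖ * ‖z‖) := by
        gcongr
        exact ContinuousLinearMap.le_opNorm _ _
    _ = _ := by ring

theorem sum_predict_sq_le_sum_norm_sq (X : Matrix (Fin m) (Fin d) ℝ)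
    (z : EuclideanSpace ℝ (Fin d)) :
    ∑ j, predict X j z ^ 2 ≤ (∑ j, ‖WithLp.toLp 2 (X j)‖ ^ 2) * ‖z‖ ^ 2 := by
  rw [Finset.sum_mul]
  refine Finset.sum_le_sum fun j _ => ?_
  rw [predict_eq_inner, ← mul_pow, ← sq_abs]
  gcongr
  exact abs_real_inner_le_norm _ _

theorem smoothConvex_squaredLoss (X : Matrix (Fin m) (Fin d) ℝ) (Y : Fin m → ℝ) :
    ∃ G, SmoothConvex (2 * ‖Matrix.toEuclideanCLM (𝕜 := ℝ) (X.transpose * X)‖)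
      (squaredLoss X Y) G := by
  have h := smoothConvex_sum_predict X (φ := fun j t => (Y j - t) ^ 2)
    (φ' := fun j s => 2 * (s - Y j)) zero_le_one
    (fun j s t => bregman_bounds_square (Y j) s t)
    (K := 2 * ‖Matrix.toEuclideanCLM (𝕜 := ℝ) (X.transpose * X)‖)
    (fun z => by linarith [sum_predict_sq_le X z])
  simp only [one_mul] at h
  exact ⟨_, h⟩

theorem smoothConvex_logisticLoss (X : Matrix (Fin m) (Fin d) ℝ) (Y : Fin m → ℝ) :
    ∃ G, SmoothConvex ((1 / (m : ℝ)) * ∑ j, ‖WithLp.toLp 2 (X j)‖ ^ 2)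
      (logisticLoss X Y) G :=
  ⟨_, smoothConvex_sum_predict X (by positivity)
    (fun j s t => bregman_bounds_logistic (Y j) s t)
    (fun z => by
      rw [one_mul, mul_assoc]
      exact mul_le_mul_of_nonneg_left (sum_predict_sq_le_sum_norm_sq X z) (by positivity))⟩

theorem squaredLoss_nonneg (X : Matrix (Fin m) (Fin d) ℝ) (Y : Fin m → ℝ)
    (w : EuclideanSpace ℝ (Fin d)) : 0 ≤ squaredLoss X Y w :=
  Finset.sum_nonneg fun _ _ => sq_nonneg _

theorem logisticLoss_nonneg (X : Matrix (Fin m) (Fin d) ℝ) {Y : Fin m → ℝ}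
    (hY : ∀ j, Y j ∈ Set.Icc (0 : ℝ) 1) (w : EuclideanSpace ℝ (Fin d)) :
    0 ≤ logisticLoss X Y w := by
  refine mul_nonneg (by positivity) (Finset.sum_nonneg fun j _ => ?_)
  have hlog : ∀ x, Real.log (Real.sigmoid x) ≤ 0 := fun x =>
    Real.log_nonpos (Real.sigmoid_nonneg x) (Real.sigmoid_le_one x)
  have h1 := mul_nonneg (hY j).1 (neg_nonneg.2 (hlog (predict X j w)))
  have h2 := mul_nonneg (sub_nonneg.2 (hY j).2) (neg_nonneg.2 (hlog (-(predict X j w))))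
  linarith

/-- Convergence rate for nonnegative convex losses with smoothness constants `K t`, when the
penalty parameter exceeds `2 (sup K + 2 μ)`. -/
theorem IsMiADMM.minStep_isLittleO_of_smooth {T : ℕ}
    {loss : Fin T → EuclideanSpace ℝ (Fin d) → ℝ} {mu lam c rho : ℝ} {w u y : ℕ → Stack T d}
    (h : IsMiADMM loss mu lam c rho w u y) (hmu : 0 ≤ mu) (hlam : 0 ≤ lam) (hc : 0 ≤ c)
    {K : Fin T → ℝ} (hK : ∀ t, 0 ≤ K t) (hrho : 2 * ((⨆ t, K t) + 2 * mu) < rho)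
    (hloss : ∀ t x, 0 ≤ loss t x) (hG : ∀ t, ∃ G, SmoothConvex (K t) (loss t) G) :
    minStep w u =o[atTop] (fun k : ℕ => 1 / (k : ℝ)) := by
  choose G hG using hG
  -- Needed for ρ > 0, also when there are no tasks.
  have hsup : 0 ≤ ⨆ t, K t := Real.iSup_nonneg hK
  refine h.minStep_isLittleO hlam hc (by linarith) (fun t => ((hG t).add_sq hmu).mono ?_)
    fun t x => add_nonneg (hloss t x) (by positivity)
  linarith [le_ciSup (Set.finite_range K).bddAbove t]

end Losses

end SRML

theorem theorem4 {T d : ℕ} {m : Fin T → ℕ}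
    (X : (t : Fin T) → Matrix (Fin (m t)) (Fin d) ℝ) (Y : (t : Fin T) → Fin (m t) → ℝ)
    (mu lam c rho : ℝ) (hmu : 0 ≤ mu) (hlam : 0 ≤ lam) (hc : 0 ≤ c)
    (w u y : ℕ → SRML.Stack T d) :
    (2 * (SRML.Hreg X + 2 * mu) < rho →
      SRML.IsMiADMM (fun t => SRML.squaredLoss (X t) (Y t)) mu lam c rho w u y →
      SRML.minStep w u =o[atTop] (fun k : ℕ => 1 / (k : ℝ))) ∧
    ((∀ t j, Y t j ∈ Set.Icc (0 : ℝ) 1) →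
      2 * (SRML.Hclass X + 2 * mu) < rho →
      SRML.IsMiADMM (fun t => SRML.logisticLoss (X t) (Y t)) mu lam c rho w u y →
      SRML.minStep w u =o[atTop] (fun k : ℕ => 1 / (k : ℝ))) := by
  constructor
  · intro hrho h
    exact h.minStep_isLittleO_of_smooth hmu hlam hc (fun t => by positivity) hrho
      (fun t x => SRML.squaredLoss_nonneg _ _ x) (fun t => SRML.smoothConvex_squaredLoss _ _)
  · intro hY hrho h
    exact h.minStep_isLittleO_of_smooth hmu hlam hc (fun t => by positivity) hrho
      (fun t x => SRML.logisticLoss_nonneg _ (hY t) x)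
      (fun t => SRML.smoothConvex_logisticLoss _ _)
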